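/- Let $S_n=\mathbb{C}[x_0,\dots,x_n]$. For a polynomial $1$-form $\eta$ on $\mathbb{C}^{n+1}$ put $J(\eta)=\{i_X\eta : X \text{ a polynomial vector field}\}$ (the ideal of coefficients of $\eta$), $$I(\eta)=\{h\in S_n:\ h\,d\eta=\eta\wedge\theta\ \text{for some } \theta\in\Omega^1_{S_n}\},\qquad K(\eta)=\mathrm{ann}(\overline{d\eta})+J(\eta),\quad \overline{d\eta}\in\Omega^2_{S_n}\otimes S_n/J(\eta),$$ the unfolding ideal and the Kupka ideal of $\eta$. Let $e\ge 2$ and let $\omega=A_0\,dx_0+A_1\,dx_1+A_2\,dx_2\neq 0$ define a codimension one foliation on $\mathbb{P}^2$: the $A_i\in S_2$ are homogeneous of degree $e-1$, $\sum x_iA_i=0$, $\omega\wedge d\omega=0$, and $\mathrm{sing}(\omega)=\{A_0=A_1=A_2=0\}\subset\mathbb{P}^2$ has codimension at least $2$. Let $F=(F_0:F_1:F_2):\mathbb{P}^n\dashrightarrow\mathbb{P}^2$ be a dominant rational map given by homogeneous polynomials $F_i\in S_n$ of the same degree $\nu$. Assume that $(F,\omega)$ is a generic pair, that is: 1. the scheme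 $\mathrm{sing}(\omega)\subset\mathbb{P}^2$ is reduced, and all its points are Kupka points, i.e. $d\omega$ does not vanish at any of them; 2. the critical values of $F$ are disjoint from $\mathrm{sing}(\omega)$: if $q\in\mathbb{C}^{n+1}\setminus\{0\}$ is a critical point of $F$ (i.e. $dF_0\wedge dF_1\wedge dF_2$ vanishes at $q$) and $F(q)\ne 0$, then $F(q)\notin\mathrm{sing}(\omega)$; 3. the set of critical points of $F$ is disjoint from $\{F_0=F_1=F_2=0\}$: no $q\in\mathbb{C}^{n+1}\setminus\{0\}$ with $F_0(q)=F_1(q)=F_2(q)=0$ is a critical point. Let $F^*\omega=\sum_i A_i(F)\,dF_i$. Then $$I(F^*\omega)=K(F^*\omega)=(A_0(F),A_1(F),A_2(F)).$$ -/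

import Mathlib

open MvPolynomial KaehlerDifferential
open scoped TensorProduct

noncomputable section

namespace Foliation

/-- The homogeneous coordinate ring `S = ℂ[x₀, …, xₙ]` of `ℙⁿ`. -/
abbrev S (n : ℕ) : Type := MvPolynomial (Fin (n + 1)) ℂ

/-- Polynomial differential `1`-forms on `ℂⁿ⁺¹` (Kähler differentials of `S` over `ℂ`). -/
abbrev Form1 (n : ℕ) : Type := Ω[S n⁄ℂ]

/-- Polynomial differential `2`-forms on `ℂⁿ⁺¹`. -/
abbrev Form2 (n : ℕ) : Type := ⋀[S n]^2 (Ω[S n⁄ℂ])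

/-- The differential `df` of a polynomial. -/
def dd {n : ℕ} (f : S n) : Form1 n := KaehlerDifferential.D ℂ (S n) f

/-- The wedge product `α ∧ β` of two `1`-forms. -/
def wedge {n : ℕ} (α β : Form1 n) : Form2 n := exteriorPower.ιMulti (S n) 2 ![α, β]

theorem wedge_add {n : ℕ} (α β γ : Form1 n) : wedge α (β + γ) = wedge α β + wedge α γ := by
  have h (x : Form1 n) : Function.update ![α, 0] 1 x = ![α, x] := by
    funext i; fin_cases i <;> rfl
  have := (exteriorPower.ιMulti (S n) 2).map_update_add ![α, 0] 1 β γ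
  rwa [h, h, h] at this

theorem wedge_smul {n : ℕ} (c : S n) (α β : Form1 n) : wedge α (c • β) = c • wedge α β := by
  have h (x : Form1 n) : Function.update ![α, 0] 1 x = ![α, x] := by
    funext i; fin_cases i <;> rfl
  have := (exteriorPower.ιMulti (S n) 2).map_update_smul ![α, 0] 1 c β
  rwa [h, h] at this

/-- The coefficient `A_i` of `dx_i` in `ω = ∑ A_i dx_i`. -/
def coeff1 {n : ℕ} (ω : Form1 n) (i : Fin (n + 1)) : S n :=
  (mvPolynomialBasis ℂ (Fin (n + 1))).repr ω i

/-- The `1`-form `∑ A_i dx_i`. -/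
def ofCoeffs {n : ℕ} (A : Fin (n + 1) → S n) : Form1 n := ∑ i, A i • dd (X i)

/-- The exterior derivative `dω = ∑ dA_i ∧ dx_i` of `ω = ∑ A_i dx_i`. -/
def extd {n : ℕ} (ω : Form1 n) : Form2 n := ∑ i, wedge (dd (coeff1 ω i)) (dd (X i))

/-- The contraction `i_X ω` of a `1`-form with a polynomial vector field `X ∈ T_S`. -/
def contract {n : ℕ} (V : Derivation ℂ (S n) (S n)) (ω : Form1 n) : S n :=
  V.liftKaehlerDifferential ω

/-- The radial vector field `R = ∑ x_i ∂/∂x_i`. -/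
def radial (n : ℕ) : Derivation ℂ (S n) (S n) := mkDerivation ℂ X

/-- `ω ∧ dω = 0`, the product being taken in the exterior algebra of `Ω¹`. -/
def Integrable {n : ℕ} (ω : Form1 n) : Prop :=
  ExteriorAlgebra.ι (S n) ω * (extd ω : ExteriorAlgebra (S n) (Form1 n)) = 0

/-- `J(ω) = { i_X ω : X ∈ T_S }`, the ideal of the singular scheme of `ω`. -/
def singularIdeal {n : ℕ} (ω : Form1 n) : Ideal (S n) where
  carrier := {h | ∃ V : Derivation ℂ (S n) (S n), contract V ω = h}
  add_mem' := by
    rintro a b ⟨V, rfl⟩ ⟨W, rfl⟩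
    refine ⟨V + W, ?_⟩
    have : (V + W).liftKaehlerDifferential
        = V.liftKaehlerDifferential + W.liftKaehlerDifferential := by
      apply Derivation.liftKaehlerDifferential_unique
      ext; simp
    simp [contract, this]
  zero_mem' := by
    refine ⟨0, ?_⟩
    have : (0 : Derivation ℂ (S n) (S n)).liftKaehlerDifferential = 0 := by
      apply Derivation.liftKaehlerDifferential_unique
      ext; simp
    simp [contract, this]
  smul_mem' := by
    rintro c a ⟨V, rfl⟩
    refine ⟨c • V, ?_⟩
    have : (c • V).liftKaehlerDifferential = c • V.liftKaehlerDifferential := by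
      apply Derivation.liftKaehlerDifferential_unique
      ext; simp
    simp [contract, this]

/-- The unfolding ideal `I(ω) = { h ∈ S : h dω = ω ∧ η for some η ∈ Ω¹_S }`. -/
def unfoldingIdeal {n : ℕ} (ω : Form1 n) : Ideal (S n) where
  carrier := {h | ∃ η : Form1 n, h • extd ω = wedge ω η}
  add_mem' := by
    rintro a b ⟨η, hη⟩ ⟨θ, hθ⟩
    refine ⟨η + θ, ?_⟩
    rw [add_smul, hη, hθ, wedge_add]
  zero_mem' := by
    refine ⟨0, ?_⟩
    have := (exteriorPower.ιMulti (S n) 2).map_coord_zero (m := ![ω, 0]) 1 rfl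
    rw [zero_smul]
    exact this.symm
  smul_mem' := by
    rintro c a ⟨η, hη⟩
    refine ⟨c • η, ?_⟩
    rw [smul_eq_mul, mul_smul, hη, wedge_smul]

/-- The Kupka ideal `K(ω) = ann(dω mod J) + J`, where `dω mod J ∈ Ω²_S ⊗ S/J` and `J = J(ω)`. -/
def kupkaIdeal {n : ℕ} (ω : Form1 n) : Ideal (S n) :=
  Ideal.torsionOf (S n) (Form2 n ⊗[S n] (S n ⧸ singularIdeal ω)) (extd ω ⊗ₜ[S n] 1)
    ⊔ singularIdeal ω

/-- `m` (a section of a module over `S`, e.g. a differential form) vanishes at the point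
`q ∈ ℂⁿ⁺¹`: its class in the fibre `M / 𝔪_q M` is zero. -/
def VanishesAt {n : ℕ} {M : Type} [AddCommGroup M] [Module (S n) M]
    (q : Fin (n + 1) → ℂ) (m : M) : Prop :=
  m ∈ RingHom.ker (eval q) • (⊤ : Submodule (S n) M)

/-- `ω ∈ 𝓕¹(ℙⁿ, e)`: `ω` is a nonzero integrable section of `Ω¹_{ℙⁿ}(e)`, `e ≥ 2`, whose singular
locus has codimension at least `2`. (A projective class of forms is given by a representative.) -/
structure IsFoliation (n e : ℕ) (ω : Form1 n) : Prop where
  two_le : 2 ≤ e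
  ne_zero : ω ≠ 0
  homogeneous : ∀ i, (coeff1 ω i).IsHomogeneous (e - 1)
  descends : contract (radial n) ω = 0
  integrable : Integrable ω
  codim_sing : 2 ≤ (singularIdeal ω).height

/-- The scheme `sing(ω) ⊆ ℙⁿ` is reduced: `J(ω)` is radical on every standard chart `x_i ≠ 0`. -/
def ReducedSing {n : ℕ} (ω : Form1 n) : Prop :=
  ∀ i : Fin (n + 1), ((singularIdeal ω).map
    (algebraMap (S n) (Localization.Away (X i : S n)))).IsRadical

/-- Every singular point of `ω` in `ℙⁿ` is a Kupka point, i.e. `dω` does not vanish there. -/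
def OnlyKupkaSing {n : ℕ} (ω : Form1 n) : Prop :=
  ∀ q : Fin (n + 1) → ℂ, q ≠ 0 → VanishesAt q ω → ¬ VanishesAt q (extd ω)

/-- The value at `q` of the polynomial map `ℂⁿ⁺¹ → ℂ³` given by `F = (F₀, F₁, F₂)`. -/
def evalMap {n : ℕ} (F : Fin 3 → S n) (q : Fin (n + 1) → ℂ) : Fin 3 → ℂ := fun i => eval q (F i)

/-- The rational map `F = (F₀ : F₁ : F₂) : ℙⁿ ⇢ ℙ²` is dominant: its image, i.e. the set of all
`(F₀(q) : F₁(q) : F₂(q))` with `F(q) ≠ 0`, is not contained in a plane curve. -/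
def IsDominating {n : ℕ} (F : Fin 3 → S n) : Prop :=
  ∀ (d : ℕ) (G : S 2), G.IsHomogeneous d →
    (∀ q : Fin (n + 1) → ℂ, evalMap F q ≠ 0 → eval (evalMap F q) G = 0) → G = 0

/-- `q` is a critical point of `F`: the derivative at `q` of the polynomial map `ℂⁿ⁺¹ → ℂ³` is not
surjective (equivalently `dF₀ ∧ dF₁ ∧ dF₂` vanishes at `q`). If `F(q) ≠ 0` and the `F_i` are
homogeneous of the same positive degree, this says, by Euler's formula, that the point of `ℙⁿ`
given by `q` is a critical point of the rational map `ℙⁿ ⇢ ℙ²`. -/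
def IsCriticalPoint {n : ℕ} (F : Fin 3 → S n) (q : Fin (n + 1) → ℂ) : Prop :=
  ¬ Function.Surjective
    (Matrix.mulVec (Matrix.of fun (i : Fin 3) (j : Fin (n + 1)) => eval q (pderiv j (F i))))

/-- The pullback `F^*ω = ∑ A_i(F) dF_i` of `ω = ∑ A_i dx_i`. -/
def pullback {n : ℕ} (F : Fin 3 → S n) (ω : Form1 2) : Form1 n :=
  ∑ i, aeval F (coeff1 ω i) • dd (F i)

/-- `(F, ω)` is a generic pair: `ω ∈ 𝓕¹(ℙ², e)` has reduced singular locus consisting of Kupka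
points only, `F : ℙⁿ ⇢ ℙ²` is a dominant rational map given by homogeneous polynomials of degree
`ν`, the critical values of `F` are not singular points of `ω`, and there are no critical points
in the indeterminacy locus `F₀ = F₁ = F₂ = 0`. -/
structure IsGenericPair (n e ν : ℕ) (F : Fin 3 → S n) (ω : Form1 2) : Prop where
  foliation : IsFoliation 2 e ω
  reduced : ReducedSing ω
  kupka : OnlyKupkaSing ω
  homogeneous : ∀ i, (F i).IsHomogeneous ν
  dominating : IsDominating F
  critical_values : ∀ q : Fin (n + 1) → ℂ, q ≠ 0 → evalMap F q ≠ 0 → IsCriticalPoint F q →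
    ¬ VanishesAt (evalMap F q) ω
  critical_points : ∀ q : Fin (n + 1) → ℂ, q ≠ 0 → evalMap F q = 0 → ¬ IsCriticalPoint F q

end Foliation

end

/-! Write `J` for the ideal of the `A_i`, `B = curl A` for the coefficients of `dω`, and `J_F` for
the ideal of the `A_i(F)`. The inclusions to prove are `J_F ⊆ I ⊆ K ⊆ J_F`.

The first follows from `A · B = 0`: contracting `ω ∧ dω = 0` with a coordinate field gives `A_i dω =
ω ∧ θ`, and this pulls back along `F`. The second holds because `ω ∧ θ` has coefficients in the
singular ideal.

For the third, Euler's formula gives `A = e⁻¹ B × x`, so the `A_i(F)` are the maximal minors of a `3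
× 2` matrix with columns `e⁻¹ B(F)` and `F`. Once they have no common factor, a Hilbert–Burch
argument (`mem_span_cross_of_mul_mem`) shows that `J_F` has no component at the origin. Membership
in `J_F` can then be tested locally at the points `q ≠ 0`. Only common zeros of the `A_i(F)` matter;
genericity makes `F` smooth there, hence flat (`IsDualFrame.flat`). If `h ∈ K`, then `h B_i(F)` lies
in `J_F` locally. The Kupka condition gives `(J : B) = J` on `ℂ³`, and flatness transports this
quotient to `h ∈ J_F` locally. The same transport shows that the `A_i(F)` have no common factor. -/

noncomputable section

namespace Foliation

/-! ### Commutative algebra: syzygies of minors, saturation, ideal quotients under flat maps. -/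

section Algebra

variable {R : Type*} [CommRing R]

/-- The prime factors of `c` are cancelled one at a time: each fails to divide some `A j`, so it
must divide the cofactor of `m`. -/
theorem dvd_of_forall_dvd_mul [IsDomain R] [UniqueFactorizationMonoid R] {ι : Type*} {A : ι → R}
    (hA : ∀ p, Prime p → ∃ j, ¬ p ∣ A j) {c : R} (hc : c ≠ 0) :
    ∀ m : R, (∀ j, c ∣ m * A j) → c ∣ m := by
  induction c using UniqueFactorizationMonoid.induction_on_prime with
  | h₁ => exact absurd rfl hc
  | h₂ x hx => exact fun m _ => hx.dvd
  | h₃ a p ha hp ih =>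
    intro m hm
    obtain ⟨m', rfl⟩ := ih ha m fun j => (Dvd.intro_left p rfl).trans (hm j)
    obtain ⟨j, hj⟩ := hA p hp
    have h := hm j
    rw [mul_comm p a, mul_assoc a m', mul_dvd_mul_iff_left ha] at h
    rw [mul_comm p a]
    exact mul_dvd_mul_left a ((hp.dvd_or_dvd h).resolve_right hj)

theorem exists_eq_mul_of_proportional [IsDomain R] [UniqueFactorizationMonoid R] {ι : Type*}
    {A v : ι → R} (hA : ∀ p, Prime p → ∃ j, ¬ p ∣ A j) (hA0 : A ≠ 0)
    (hv : ∀ i j, v i * A j = v j * A i) : ∃ α, ∀ i, v i = α * A i := by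
  obtain ⟨i, hi⟩ := Function.ne_iff.mp hA0
  obtain ⟨α, hα⟩ := dvd_of_forall_dvd_mul hA hi (v i) fun j => ⟨v j, by rw [hv i j, mul_comm]⟩
  refine ⟨α, fun j => mul_right_cancel₀ hi ?_⟩
  rw [hv j i, hα]
  ring

/-- The cross product of two vectors of length three. -/
def cross (a b : Fin 3 → R) : Fin 3 → R :=
  ![a 1 * b 2 - a 2 * b 1, a 2 * b 0 - a 0 * b 2, a 0 * b 1 - a 1 * b 0]

theorem cross_independent [IsDomain R] {a b : Fin 3 → R} (h0 : cross a b ≠ 0) {α β : R}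
    (h : ∀ i, α * a i + β * b i = 0) : α = 0 ∧ β = 0 := by
  obtain ⟨i, hi⟩ := Function.ne_iff.mp h0
  have e0 := h 0
  have e1 := h 1
  have e2 := h 2
  have ha : α * cross a b i = 0 := by
    fin_cases i <;> simp only [cross, Fin.zero_eta, Fin.mk_one, Fin.reduceFinMk, Matrix.cons_val]
    · linear_combination b 2 * e1 - b 1 * e2
    · linear_combination b 0 * e2 - b 2 * e0
    · linear_combination b 1 * e0 - b 0 * e1
  have hb : β * cross a b i = 0 := by
    fin_cases i <;> simp only [cross, Fin.zero_eta, Fin.mk_one, Fin.reduceFinMk, Matrix.cons_val]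
    · linear_combination a 1 * e2 - a 2 * e1
    · linear_combination a 2 * e0 - a 0 * e2
    · linear_combination a 0 * e1 - a 1 * e0
  exact ⟨(mul_eq_zero.mp ha).resolve_right hi, (mul_eq_zero.mp hb).resolve_right hi⟩

/-- The syzygies of the `2 × 2` minors of a `3 × 2` matrix are generated by its columns, if the
minors have no common factor. -/
theorem syzygy_of_cross [IsDomain R] [UniqueFactorizationMonoid R] {a b u : Fin 3 → R}
    (h0 : cross a b ≠ 0) (hA : ∀ p, Prime p → ∃ j, ¬ p ∣ cross a b j)
    (hu : ∑ i, u i * cross a b i = 0) : ∃ α β, ∀ i, u i = α * a i + β * b i := by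
  have hu' := hu
  simp only [Fin.sum_univ_three, cross, Matrix.cons_val] at hu'
  -- Cramer's rule: `u × b` and `a × u` are both proportional to `a × b` because `det (u, a, b) =
  -- 0`. The two factors are the coefficients of `u`.
  obtain ⟨α, hα⟩ := exists_eq_mul_of_proportional (v := cross u b) hA h0 (by
    intro i j
    fin_cases i <;> fin_cases j <;> simp [cross]
    · linear_combination (b 2) * hu'
    · linear_combination (-b 1) * hu'
    · linear_combination (-b 2) * hu'
    · linear_combination (b 0) * hu'
    · linear_combination (b 1) * hu'
    · linear_combination (-b 0) * hu')
  obtain ⟨β, hβ⟩ := exists_eq_mul_of_proportional (v := cross a u) hA h0 (by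
    intro i j
    fin_cases i <;> fin_cases j <;> simp [cross]
    · linear_combination (-a 2) * hu'
    · linear_combination (a 1) * hu'
    · linear_combination (a 2) * hu'
    · linear_combination (-a 0) * hu'
    · linear_combination (-a 1) * hu'
    · linear_combination (a 0) * hu')
  refine ⟨α, β, ?_⟩
  obtain ⟨i, hi⟩ := Function.ne_iff.mp h0
  have a0 := hα 0
  have a1 := hα 1
  have a2 := hα 2
  have b0 := hβ 0
  have b1 := hβ 1
  have b2 := hβ 2
  simp only [cross, Matrix.cons_val] at a0 a1 a2 b0 b1 b2
  intro j
  refine sub_eq_zero.mp ((mul_eq_zero.mp (?_ : cross a b i * _ = 0)).resolve_left hi)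
  fin_cases i <;> fin_cases j <;>
    simp only [cross, Fin.zero_eta, Fin.mk_one, Fin.reduceFinMk, Matrix.cons_val]
  · linear_combination b 0 * b0 + a 0 * a0 + hu'
  · linear_combination b 1 * b0 + a 1 * a0
  · linear_combination b 2 * b0 + a 2 * a0
  · linear_combination b 0 * b1 + a 0 * a1
  · linear_combination b 1 * b1 + a 1 * a1 + hu'
  · linear_combination b 2 * b1 + a 2 * a1
  · linear_combination b 0 * b2 + a 0 * a2
  · linear_combination b 1 * b2 + a 1 * a2
  · linear_combination b 2 * b2 + a 2 * a2 + hu'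

/-- A weak form of regularity of a sequence of length three. -/
structure IsRegularTriple (G : Fin 3 → R) : Prop where
  ne_zero : G 0 ≠ 0
  second : ∀ m, G 0 ∣ m * G 1 → G 0 ∣ m
  third : ∀ m, m * G 2 ∈ Ideal.span {G 0, G 1} → m ∈ Ideal.span {G 0, G 1}

/-- Exactness of the Koszul complex at its first syzygies, with the Koszul relations written as a
cross product. -/
theorem IsRegularTriple.koszul [IsDomain R] {G u : Fin 3 → R} (hG : IsRegularTriple G)
    (hu : ∑ i, u i * G i = 0) : ∃ s, u = cross G s := by
  rw [Fin.sum_univ_three] at hu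
  obtain ⟨s₀, s₁, hs⟩ := Ideal.mem_span_pair.mp (hG.third (u 2) (Ideal.mem_span_pair.mpr
    ⟨-u 0, -u 1, by linear_combination -hu⟩))
  obtain ⟨t, ht⟩ := hG.second (u 1 + s₁ * G 2) ⟨-(u 0 + s₀ * G 2), by
    linear_combination hu + G 2 * hs⟩
  have h0 : u 0 = - s₀ * G 2 - t * G 1 := mul_right_cancel₀ hG.ne_zero (by
    linear_combination hu + G 2 * hs - G 1 * ht)
  refine ⟨![-s₁, s₀, -t], ?_⟩
  funext i
  fin_cases i <;> simp [cross]
  · linear_combination h0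
  · linear_combination ht
  · linear_combination -hs

/-- The ideal of `2 × 2` minors of a `3 × 2` matrix, if it has no common factor, is saturated with
respect to every regular sequence of length three. -/
theorem mem_span_cross_of_mul_mem [IsDomain R] [UniqueFactorizationMonoid R] {a b G : Fin 3 → R}
    (h0 : cross a b ≠ 0) (hA : ∀ p, Prime p → ∃ j, ¬ p ∣ cross a b j) (hG : IsRegularTriple G)
    {h : R} (hh : ∀ i, h * G i ∈ Ideal.span (Set.range (cross a b))) :
    h ∈ Ideal.span (Set.range (cross a b)) := by
  simp only [Ideal.mem_span_range_iff_exists_fun] at hh ⊢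
  choose w hw using hh
  -- Comparing two expressions of `h G_i G_k` in the minors yields syzygies, hence coefficients `α i
  -- k`, `β i k` along the two columns.
  have key (i k : Fin 3) := syzygy_of_cross (u := fun j => G k * w i j - G i * w k j) h0 hA (by
    have h1 := hw i
    have h2 := hw k
    simp only [Fin.sum_univ_three] at h1 h2 ⊢
    linear_combination G k * h1 - G i * h2)
  choose α β hr using key
  -- These coefficients satisfy a cocycle relation. Koszul exactness makes them coboundaries of `s`
  -- and `t`, which correct `w 0` to a multiple of `G 0`. The correction is invisible after pairing
  -- with `a × b`.
  have hcoc := cross_independent h0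
    (α := α 1 2 * G 0 + α 2 0 * G 1 + α 0 1 * G 2) (β := β 1 2 * G 0 + β 2 0 * G 1 + β 0 1 * G 2)
    (fun j => by linear_combination -G 0 * hr 1 2 j - G 1 * hr 2 0 j - G 2 * hr 0 1 j)
  obtain ⟨s, hs⟩ := hG.koszul (u := ![α 1 2, α 2 0, α 0 1]) (by
    simpa [Fin.sum_univ_three] using hcoc.1)
  obtain ⟨t, ht⟩ := hG.koszul (u := ![β 1 2, β 2 0, β 0 1]) (by
    simpa [Fin.sum_univ_three] using hcoc.2)
  have hs2 := congrFun hs 2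
  have ht2 := congrFun ht 2
  simp only [cross, Matrix.cons_val] at hs2 ht2
  have hdvd (j : Fin 3) : G 0 ∣ w 0 j + s 0 * a j + t 0 * b j :=
    hG.second _ ⟨w 1 j + s 1 * a j + t 1 * b j, by
      linear_combination hr 0 1 j + a j * hs2 + b j * ht2⟩
  choose c hc using hdvd
  refine ⟨c, mul_left_cancel₀ hG.ne_zero ?_⟩
  have h1 := hw 0
  have c0 := hc 0
  have c1 := hc 1
  have c2 := hc 2
  simp only [Fin.sum_univ_three, cross, Matrix.cons_val] at h1 ⊢
  linear_combination h1 - (a 1 * b 2 - a 2 * b 1) * c0 - (a 2 * b 0 - a 0 * b 2) * c1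
    - (a 0 * b 1 - a 1 * b 0) * c2

theorem isRegularTriple_X_pow {σ k : Type*} [Field k] {i : Fin 3 → σ} (hi : Function.Injective i)
    (N : ℕ) : IsRegularTriple fun j => (X (i j) ^ N : MvPolynomial σ k) := by
  have h01 : i 0 ≠ i 1 := hi.ne (by decide)
  have h02 : i 0 ≠ i 2 := hi.ne (by decide)
  have h12 : i 1 ≠ i 2 := hi.ne (by decide)
  refine ⟨pow_ne_zero _ (X_ne_zero _), fun m hm => ?_, fun m hm => ?_⟩
  · rw [mul_comm] at hm
    exact X_prime.pow_dvd_of_dvd_mul_left N (fun h => h01 (X_dvd_X.mp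
      (X_prime.dvd_of_dvd_pow h))) hm
  · have hspan : Ideal.span {(X (i 0) ^ N : MvPolynomial σ k), X (i 1) ^ N} =
        Ideal.span ((fun s => monomial s 1) '' {Finsupp.single (i 0) N, Finsupp.single (i 1) N}) := by
      rw [Set.image_pair, X_pow_eq_monomial, X_pow_eq_monomial]
    rw [hspan, mem_ideal_span_monomial_image] at hm ⊢
    intro d hd
    -- Multiplying by a power of `X (i 2)` shifts the support without changing the exponents of `X
    -- (i 0)` and `X (i 1)`.
    obtain ⟨s, hs, hle⟩ := hm (d + Finsupp.single (i 2) N) (by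
      rw [mem_support_iff] at hd ⊢
      rwa [X_pow_eq_monomial, coeff_mul_monomial, mul_one])
    refine ⟨s, hs, ?_⟩
    rcases hs with rfl | rfl
    · rw [Finsupp.single_le_iff] at hle ⊢
      simpa [Finsupp.single_apply, h02.symm] using hle
    · rw [Finsupp.single_le_iff] at hle ⊢
      simpa [Finsupp.single_apply, h12.symm] using hle

/-- The hypothesis says that `J` is the kernel of `h ↦ (b_i h)` from `R` to `(R/J)^ι`; tensoring
with the flat algebra `T` keeps this exact. -/
theorem mem_map_of_flat {T ι : Type*} [CommRing T] [Algebra R T] [Module.Flat R T] [Fintype ι]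
    {J : Ideal R} {b : ι → R} (hJ : ∀ h, (∀ i, b i * h ∈ J) → h ∈ J) {t : T}
    (ht : ∀ i, algebraMap R T (b i) * t ∈ J.map (algebraMap R T)) : t ∈ J.map (algebraMap R T) := by
  classical
  let g : R →ₗ[R] (ι → R ⧸ J) := LinearMap.pi fun i => (J.mkQ).comp (LinearMap.mulLeft R (b i))
  have hex : Function.Exact (Submodule.subtype J) g := by
    intro h
    simp only [g, funext_iff, LinearMap.pi_apply, LinearMap.comp_apply, LinearMap.mulLeft_apply,
      Pi.zero_apply, Submodule.mkQ_apply, Submodule.Quotient.mk_eq_zero, Submodule.coe_subtype]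
    exact ⟨fun hh => ⟨⟨h, hJ h hh⟩, rfl⟩, by rintro ⟨y, rfl⟩ i; exact J.mul_mem_left _ y.2⟩
  have hex' := Module.Flat.lTensor_exact T hex
  have : g.lTensor T (t ⊗ₜ 1) = 0 := by
    apply (TensorProduct.piRight R R T (fun _ : ι => R ⧸ J)).injective
    funext i
    have hi : (b i • t) ⊗ₜ[R] (1 : R ⧸ J) = 0 := by
      rw [Algebra.smul_def]
      have hz : ∀ z ∈ J.map (algebraMap R T), z ⊗ₜ[R] (1 : R ⧸ J) = 0 := by
        intro z hz
        induction hz using Submodule.span_induction with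
        | mem x hx =>
          obtain ⟨r, hr, rfl⟩ := hx
          rw [Algebra.algebraMap_eq_smul_one, TensorProduct.smul_tmul, Algebra.smul_def, mul_one,
            Ideal.Quotient.algebraMap_eq, Ideal.Quotient.eq_zero_iff_mem.mpr hr,
            TensorProduct.tmul_zero]
        | zero => simp
        | add x y _ _ hx hy => rw [TensorProduct.add_tmul, hx, hy, add_zero]
        | smul a x _ hx =>
          have := congrArg (TensorProduct.map (LinearMap.mulLeft R a) LinearMap.id) hx
          simpa using this
      exact hz _ (ht i)
    rw [TensorProduct.smul_tmul, Algebra.smul_def, mul_one] at hi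
    simpa [g] using hi
  obtain ⟨y, hy⟩ := (hex' _).mp this
  have : ∀ y : T ⊗[R] J, TensorProduct.rid R T (J.subtype.lTensor T y) ∈ J.map (algebraMap R T) := by
    intro y
    induction y with
    | zero => simp
    | add x y hx hy => simpa using add_mem hx hy
    | tmul x y =>
      simp [Algebra.smul_def]
      exact Ideal.mul_mem_right _ _ (Ideal.mem_map_of_mem _ y.2)
  have h2 := this y
  rw [hy] at h2
  simpa using h2

end Algebra

/-! ### Flatness of a polynomial map where it is a submersion. -/

section Flatness

/-- Formal smoothness of `R → T` from that of `k → T` and a splitting of `T ⊗ Ω_R → Ω_T`. -/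
theorem formallySmooth_of_retraction {k R T : Type*} [CommRing k] [CommRing R] [CommRing T]
    [Algebra k R] [Algebra k T] [Algebra R T] [IsScalarTower k R T] [Algebra.FormallySmooth k T]
    (ρ : Ω[T⁄k] →ₗ[T] T ⊗[R] Ω[R⁄k]) (hρ : ρ ∘ₗ mapBaseChange k R T = LinearMap.id) :
    Algebra.FormallySmooth R T := by
  refine ⟨?_, ⟨fun x y => ?_⟩⟩
  · obtain ⟨l, hl⟩ := (((KaehlerDifferential.exact_mapBaseChange_map k R T).split_tfae'
      (R := T)).out 1 0 rfl rfl).mp ⟨KaehlerDifferential.map_surjective k R T, ρ, hρ⟩ |>.2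
    exact Module.Projective.of_split l (KaehlerDifferential.map k R T T) hl
  -- In the Jacobi–Zariski sequence, `H₁` of `T` over `k` vanishes, so `δ` is injective. Its image
  -- is killed by `mapBaseChange`, which `ρ` makes injective, so `H₁` of `T` over `R` is zero.
  · have hδ : Function.Injective (Algebra.H1Cotangent.δ k R T) := by
      rw [injective_iff_map_eq_zero]
      intro z hz
      obtain ⟨w, rfl⟩ := (Algebra.H1Cotangent.exact_map_δ k R T z).mp hz
      rw [Subsingleton.elim w 0, map_zero]
    have h0 : ∀ z, Algebra.H1Cotangent.δ k R T z = 0 := fun z => by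
      have h1 := (Algebra.H1Cotangent.exact_δ_mapBaseChange k R T).apply_apply_eq_zero z
      have h2 := LinearMap.congr_fun hρ (Algebra.H1Cotangent.δ k R T z)
      rw [LinearMap.comp_apply, h1, map_zero] at h2
      exact h2.symm
    exact hδ ((h0 x).trans (h0 y).symm)

/-- Vector fields `V j` with `V j (F i) = δ` if `i = j`, and `0` otherwise. -/
def IsDualFrame {k σ ι : Type*} [DecidableEq ι] [CommRing k] (F : ι → MvPolynomial σ k)
    (δ : MvPolynomial σ k)
    (V : ι → Derivation k (MvPolynomial σ k) (MvPolynomial σ k)) : Prop :=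
  ∀ i j, V j (F i) = if i = j then δ else 0

/-- Contraction with the fields `V j / δ` splits `T ⊗ Ω → Ω_T`. Hence the map is formally smooth;
being of finite presentation, it is smooth and so flat. -/
theorem IsDualFrame.flat {k σ ι T : Type*} [Finite σ] [Fintype ι] [DecidableEq ι] [Field k]
    {F : ι → MvPolynomial σ k} {δ : MvPolynomial σ k}
    {V : ι → Derivation k (MvPolynomial σ k) (MvPolynomial σ k)} (hV : IsDualFrame F δ V)
    [CommRing T] [Algebra k T] [Algebra (MvPolynomial σ k) T] [IsScalarTower k (MvPolynomial σ k) T]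
    [IsLocalization.Away δ T] [Algebra (MvPolynomial ι k) T]
    [IsScalarTower k (MvPolynomial ι k) T]
    (hF : ∀ i, algebraMap (MvPolynomial ι k) T (X i) = algebraMap (MvPolynomial σ k) T (F i)) :
    Module.Flat (MvPolynomial ι k) T := by
  have : Algebra.FormallyEtale (MvPolynomial σ k) T := .of_isLocalization (Submonoid.powers δ)
  have : Algebra.FormallySmooth k T := .comp k (MvPolynomial σ k) T
  let u : T := IsLocalization.Away.invSelf δ
  have hu : algebraMap (MvPolynomial σ k) T δ * u = 1 := IsLocalization.Away.mul_invSelf δ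
  let e := tensorKaehlerEquivOfFormallyEtale k (MvPolynomial σ k) T
  let W (j : ι) : Ω[T⁄k] →ₗ[T] T :=
    (LinearMap.liftBaseChange T ((Algebra.linearMap (MvPolynomial σ k) T).comp (V j).liftKaehlerDifferential)).comp
      e.symm.toLinearMap
  let ρ : Ω[T⁄k] →ₗ[T] T ⊗[MvPolynomial ι k] Ω[MvPolynomial ι k⁄k] :=
    ∑ j, (W j).smulRight (u ⊗ₜ D k _ (X j))
  have hW (i j : ι) : W j (KaehlerDifferential.D k T (algebraMap (MvPolynomial ι k) T (X i))) =
      if i = j then algebraMap (MvPolynomial σ k) T δ else 0 := by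
    rw [hF]
    simp only [W, e, LinearMap.comp_apply, LinearEquiv.coe_coe,
      tensorKaehlerEquivOfFormallyEtale_symm_D_algebraMap]
    simp only [LinearMap.liftBaseChange_tmul, one_smul, LinearMap.comp_apply,
      Derivation.liftKaehlerDifferential_comp_D, hV i j, Algebra.linearMap_apply]
    split_ifs <;> simp
  have : Algebra.FormallySmooth (MvPolynomial ι k) T := by
    refine formallySmooth_of_retraction (k := k) ρ ?_
    refine ((mvPolynomialBasis k ι).baseChange T).ext fun i => ?_
    simp only [Module.Basis.baseChange_apply, mvPolynomialBasis_apply, LinearMap.comp_apply,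
      mapBaseChange_tmul, one_smul, map_D, ρ, LinearMap.sum_apply, LinearMap.smulRight_apply, hW,
      LinearMap.id_apply]
    rw [Finset.sum_eq_single i (by intro j _ hj; rw [if_neg hj.symm, zero_smul]) (by simp), if_pos rfl,
      TensorProduct.smul_tmul', smul_eq_mul, hu]
  have : Algebra.FinitePresentation (MvPolynomial σ k) T :=
    IsLocalization.Away.finitePresentation δ
  have : Algebra.FiniteType k T := .trans (S := MvPolynomial σ k) inferInstance inferInstance
  have : Algebra.FiniteType (MvPolynomial ι k) T := .of_restrictScalars_finiteType k _ _
  have : Algebra.FinitePresentation (MvPolynomial ι k) T :=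
    Algebra.FinitePresentation.of_finiteType.mp ‹_›
  have : Algebra.Smooth (MvPolynomial ι k) T := {}
  exact Algebra.Smooth.flat (MvPolynomial ι k) T

end Flatness

/-! ### Calculus of forms: pullback, curl, and the general inclusions of ideals. -/

section Forms

variable {n : ℕ}

theorem wedge_self (α : Form1 n) : wedge α α = 0 :=
  (exteriorPower.ιMulti (S n) 2).map_eq_zero_of_eq ![α, α] (i := 0) (j := 1) rfl (by decide)

theorem wedge_swap (α β : Form1 n) : wedge α β = - wedge β α := by
  have h := (exteriorPower.ιMulti (S n) 2).map_swap ![β, α] (i := 0) (j := 1) (by decide)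
  have h' : ![β, α] ∘ Equiv.swap 0 1 = ![α, β] := by funext i; fin_cases i <;> rfl
  rwa [h'] at h

theorem add_wedge (α β γ : Form1 n) : wedge (α + β) γ = wedge α γ + wedge β γ := by
  rw [wedge_swap, wedge_add, neg_add, ← wedge_swap, ← wedge_swap]

theorem smul_wedge (c : S n) (α β : Form1 n) : wedge (c • α) β = c • wedge α β := by
  rw [wedge_swap, wedge_smul, wedge_swap α β]
  exact (smul_neg c (wedge β α)).symm

/-- The wedge product as a bilinear map. -/
def wedgeₗ (n : ℕ) : Form1 n →ₗ[S n] Form1 n →ₗ[S n] Form2 n :=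
  LinearMap.mk₂ (S n) wedge add_wedge smul_wedge wedge_add wedge_smul

/-- The contraction of a `2`-form with two vector fields. -/
def contract₂ (V W : Derivation ℂ (S n) (S n)) : Form2 n →ₗ[S n] S n :=
  exteriorPower.alternatingMapLinearEquiv
    { toFun := fun m => contract V (m 0) * contract W (m 1) - contract V (m 1) * contract W (m 0)
      map_update_add' := by
        intro _ m i x y
        fin_cases i <;> simp [contract, Function.update] <;> ring
      map_update_smul' := by
        intro _ m i c x
        fin_cases i <;> simp [contract, Function.update] <;> ring
      map_eq_zero_of_eq' := by
        intro v i j h hij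
        fin_cases i <;> fin_cases j <;> simp_all }

theorem contract₂_wedge (V W : Derivation ℂ (S n) (S n)) (α β : Form1 n) :
    contract₂ V W (wedge α β) = contract V α * contract W β - contract V β * contract W α := by
  rw [contract₂, wedge, exteriorPower.alternatingMapLinearEquiv_apply_ιMulti]
  rfl

@[simp]
theorem contract_dd (V : Derivation ℂ (S n) (S n)) (f : S n) : contract V (dd f) = V f := by
  simp [contract, dd]

theorem dd_eq_sum (f : S n) : dd f = ∑ i, pderiv i f • dd (X i) := by
  have h := (mvPolynomialBasis ℂ (Fin (n + 1))).sum_repr (dd f)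
  simpa [dd] using h.symm

theorem coeff1_smul_dd (f g : S n) (i : Fin (n + 1)) : coeff1 (f • dd g) i = f * pderiv i g := by
  simp [coeff1, dd]

theorem coeff1_ofCoeffs (A : Fin (n + 1) → S n) (i : Fin (n + 1)) :
    coeff1 (ofCoeffs A) i = A i := by
  simp [coeff1, ofCoeffs, dd, Finsupp.single_apply]

theorem dd_add (f g : S n) : dd (f + g) = dd f + dd g := map_add _ _ _

theorem dd_mul (f g : S n) : dd (f * g) = f • dd g + g • dd f := (D ℂ (S n)).leibniz f g

theorem pderiv_comm (i j : Fin (n + 1)) (f : S n) :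
    pderiv i (pderiv j f) = pderiv j (pderiv i f) := by
  have h : ⁅(pderiv i : Derivation ℂ (S n) (S n)), (pderiv j : Derivation ℂ (S n) (S n))⁆ = 0 := by
    refine MvPolynomial.derivation_ext fun k => ?_
    simp [Derivation.commutator_apply, pderiv_X, Pi.single_apply, apply_ite]
  rw [← sub_eq_zero, ← Derivation.commutator_apply, h, Derivation.zero_apply]

theorem extd_add (α β : Form1 n) : extd (α + β) = extd α + extd β := by
  simp only [extd, coeff1, map_add, Finsupp.add_apply, dd_add, add_wedge, Finset.sum_add_distrib]

/-- This is `d² = 0`: symmetric second derivatives against an antisymmetric product give a sum equal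
to its own negative. -/
theorem sum_wedge_dd_pderiv (g : S n) : ∑ i, wedge (dd (pderiv i g)) (dd (X i)) = 0 := by
  have h : ∑ i, wedge (dd (pderiv i g)) (dd (X i)) =
      ∑ i, ∑ j, pderiv j (pderiv i g) • wedge (dd (X j)) (dd (X i)) := by
    refine Finset.sum_congr rfl fun i _ => ?_
    conv_lhs => rw [dd_eq_sum (pderiv i g)]
    change (wedgeₗ n).flip (dd (X i)) (∑ j, _) = _
    simp [wedgeₗ]
  have h2 : ∑ i, wedge (dd (pderiv i g)) (dd (X i)) =
      - ∑ i, wedge (dd (pderiv i g)) (dd (X i)) := by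
    conv_lhs => rw [h, Finset.sum_comm]
    rw [h, ← Finset.sum_neg_distrib]
    refine Finset.sum_congr rfl fun i _ => ?_
    rw [← Finset.sum_neg_distrib]
    refine Finset.sum_congr rfl fun j _ => ?_
    rw [wedge_swap, smul_neg, pderiv_comm]
  have h3 : (2 : ℂ) • ∑ i, wedge (dd (pderiv i g)) (dd (X i)) = 0 := by
    rw [two_smul]
    nth_rewrite 1 [h2]
    exact neg_add_cancel _
  exact (smul_eq_zero_iff_right (two_ne_zero)).mp h3

theorem extd_smul_dd (f g : S n) : extd (f • dd g) = wedge (dd f) (dd g) := by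
  simp only [extd, coeff1_smul_dd, dd_mul, add_wedge, smul_wedge, Finset.sum_add_distrib]
  rw [← Finset.smul_sum, sum_wedge_dd_pderiv, smul_zero, zero_add]
  conv_rhs => rw [dd_eq_sum g]
  change _ = wedgeₗ n (dd f) (∑ j, _)
  simp [wedgeₗ]

theorem pullback_ofCoeffs (F : Fin 3 → S n) (A : Fin 3 → S 2) :
    pullback F (ofCoeffs A) = ∑ i, aeval F (A i) • dd (F i) := by
  simp only [pullback, coeff1_ofCoeffs]

theorem dd_aeval (F : Fin 3 → S n) (f : S 2) :
    dd (aeval F f) = ∑ j, aeval F (pderiv j f) • dd (F j) := by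
  induction f using MvPolynomial.induction_on with
  | C a => simp [dd]
  | add p q hp hq => simp only [map_add, dd_add, hp, hq, add_smul, Finset.sum_add_distrib]
  | mul_X p i hp =>
    rw [map_mul, aeval_X, dd_mul, hp]
    simp [Derivation.leibniz, add_smul, Finset.sum_add_distrib, pderiv_X, Pi.single_apply,
      Finset.smul_sum, mul_smul, apply_ite]

theorem extd_pullback (F : Fin 3 → S n) (A : Fin 3 → S 2) :
    extd (pullback F (ofCoeffs A)) = ∑ i, wedge (dd (aeval F (A i))) (dd (F i)) := by
  simp only [pullback_ofCoeffs, Fin.sum_univ_three, extd_add, extd_smul_dd]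

/-- The curl of a polynomial vector field on `ℂ³`. -/
def curl (A : Fin 3 → S 2) : Fin 3 → S 2 :=
  ![pderiv 1 (A 2) - pderiv 2 (A 1), pderiv 2 (A 0) - pderiv 0 (A 2),
    pderiv 0 (A 1) - pderiv 1 (A 0)]

theorem extd_pullback_eq_curl (F : Fin 3 → S n) (A : Fin 3 → S 2) :
    extd (pullback F (ofCoeffs A)) = aeval F (curl A 0) • wedge (dd (F 1)) (dd (F 2)) +
      aeval F (curl A 1) • wedge (dd (F 2)) (dd (F 0)) +
      aeval F (curl A 2) • wedge (dd (F 0)) (dd (F 1)) := by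
  simp only [extd_pullback, dd_aeval, Fin.sum_univ_three, add_wedge, smul_wedge, wedge_self,
    wedge_swap (dd (F 2)) (dd (F 1)), wedge_swap (dd (F 0)) (dd (F 2)),
    wedge_swap (dd (F 1)) (dd (F 0)), curl, Matrix.cons_val, map_sub, smul_zero]
  module

/-- Lets the formulas for pullbacks be specialised to `ω` itself. -/
theorem pullback_X (ω : Form1 2) : pullback X ω = ω := by
  have h := (mvPolynomialBasis ℂ (Fin 3)).sum_repr ω
  simpa [pullback, dd, coeff1] using h

theorem contract_pullback (V : Derivation ℂ (S n) (S n)) (F : Fin 3 → S n) (A : Fin 3 → S 2) :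
    contract V (pullback F (ofCoeffs A)) = ∑ i, aeval F (A i) * V (F i) := by
  rw [pullback_ofCoeffs, ← Finset.sum_congr rfl fun i _ => congrArg (_ * ·) (contract_dd V (F i))]
  simp [contract]

/-- A dual frame reads off the coefficients of `F^*dω`, up to one factor `δ` for each of the two
fields. -/
theorem contract₂_extd_pullback {F : Fin 3 → S n} {δ : S n}
    {V : Fin 3 → Derivation ℂ (S n) (S n)} (hV : IsDualFrame F δ V) (A : Fin 3 → S 2) :
    contract₂ (V 1) (V 2) (extd (pullback F (ofCoeffs A))) = δ ^ 2 * aeval F (curl A 0) ∧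
    contract₂ (V 2) (V 0) (extd (pullback F (ofCoeffs A))) = δ ^ 2 * aeval F (curl A 1) ∧
    contract₂ (V 0) (V 1) (extd (pullback F (ofCoeffs A))) = δ ^ 2 * aeval F (curl A 2) := by
  have hV' := fun i j => hV i j
  simp only [extd_pullback_eq_curl, map_add, map_smul, contract₂_wedge, contract_dd, hV']
  refine ⟨?_, ?_, ?_⟩ <;> simp <;> ring

theorem singularIdeal_pullback_le (F : Fin 3 → S n) (A : Fin 3 → S 2) :
    singularIdeal (pullback F (ofCoeffs A)) ≤ Ideal.span (Set.range fun i => aeval F (A i)) := by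
  rintro _ ⟨V, rfl⟩
  rw [contract_pullback]
  exact Ideal.sum_mem _ fun i _ => Ideal.mul_mem_right _ _ (Ideal.subset_span ⟨i, rfl⟩)

theorem singularIdeal_ofCoeffs_le (A : Fin 3 → S 2) :
    singularIdeal (ofCoeffs A) ≤ Ideal.span (Set.range A) := by
  have h := singularIdeal_pullback_le X A
  simpa [pullback_X] using h

/-- Pairing with two fields turns the annihilator condition in `Ω² ⊗ S/J` into membership in `J`. -/
theorem mul_contract₂_mem_of_torsion {ω : Form1 n} {h : S n}
    (hh : h ∈ Ideal.torsionOf (S n) (Form2 n ⊗[S n] (S n ⧸ singularIdeal ω)) (extd ω ⊗ₜ[S n] 1))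
    (V W : Derivation ℂ (S n) (S n)) : h * contract₂ V W (extd ω) ∈ singularIdeal ω := by
  rw [Ideal.mem_torsionOf_iff] at hh
  have h1 := congrArg (LinearMap.rTensor (S n ⧸ singularIdeal ω) (contract₂ V W)) hh
  have h2 := congrArg (TensorProduct.lid (S n) (S n ⧸ singularIdeal ω)) h1
  simp only [map_smul, LinearMap.rTensor_tmul, TensorProduct.lid_tmul, map_zero] at h2
  rw [← Ideal.Quotient.eq_zero_iff_mem, map_mul]
  have h3 (x : S n) : x • (1 : S n ⧸ singularIdeal ω) = Ideal.Quotient.mk _ x :=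
    congrArg (Ideal.Quotient.mk _) (mul_one x)
  rw [← h3 (contract₂ V W _)]
  exact h2

theorem unfoldingIdeal_le_kupkaIdeal (ω : Form1 n) : unfoldingIdeal ω ≤ kupkaIdeal ω := by
  refine le_trans ?_ le_sup_left
  rintro h ⟨θ, hθ⟩
  rw [Ideal.mem_torsionOf_iff, TensorProduct.smul_tmul', hθ]
  have hω : ω = ∑ i, coeff1 ω i • dd (X i) := by
    have h := (mvPolynomialBasis ℂ (Fin (n + 1))).sum_repr ω
    simpa [dd, coeff1] using h.symm
  have hmem (i : Fin (n + 1)) : coeff1 ω i ∈ singularIdeal ω := by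
    refine ⟨pderiv i, ?_⟩
    conv_lhs => rw [hω]
    simp [contract, dd, pderiv_X, Pi.single_apply]
  have hw : wedge ω θ = ∑ i, coeff1 ω i • wedge (dd (X i)) θ := by
    conv_lhs => rw [hω]
    change (wedgeₗ n).flip θ (∑ j, _) = _
    simp [wedgeₗ]
  rw [hw, TensorProduct.sum_tmul]
  refine Finset.sum_eq_zero fun i _ => ?_
  have h0 : coeff1 ω i • (1 : S n ⧸ singularIdeal ω) = 0 := by
    rw [← map_one (Ideal.Quotient.mk (singularIdeal ω))]
    exact Ideal.Quotient.eq_zero_iff_mem.mpr (by simpa using hmem i)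
  rw [TensorProduct.smul_tmul, h0, TensorProduct.tmul_zero]

theorem aeval_mem_unfoldingIdeal (F : Fin 3 → S n) (A : Fin 3 → S 2)
    (hAB : ∑ i, A i * curl A i = 0) (i : Fin 3) :
    aeval F (A i) ∈ unfoldingIdeal (pullback F (ofCoeffs A)) := by
  have h := congrArg (aeval F) hAB
  simp only [Fin.sum_univ_three, map_add, map_mul, map_zero] at h
  have hw : ∀ α, wedge (pullback F (ofCoeffs A)) α = ∑ i, aeval F (A i) • wedge (dd (F i)) α := by
    intro α
    simp only [pullback_ofCoeffs, Fin.sum_univ_three, add_wedge, smul_wedge]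
  have hsub : ∀ α β γ : Form1 n, wedge α (β - γ) = wedge α β - wedge α γ := fun α =>
    map_sub (wedgeₗ n α)
  fin_cases i
  -- The witness is the pullback of the contraction of `dω` with `∂/∂x_0`; the other two cases use
  -- `∂/∂x_1` and `∂/∂x_2`.
  · refine ⟨aeval F (curl A 2) • dd (F 1) - aeval F (curl A 1) • dd (F 2), ?_⟩
    simp only [hw, extd_pullback_eq_curl, Fin.sum_univ_three, hsub, wedge_smul, wedge_self,
      wedge_swap (dd (F 2)) (dd (F 1)), wedge_swap (dd (F 0)) (dd (F 2)), Fin.zero_eta]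
    linear_combination (norm := module) h • wedge (dd (F 1)) (dd (F 2))
  · refine ⟨aeval F (curl A 0) • dd (F 2) - aeval F (curl A 2) • dd (F 0), ?_⟩
    simp only [hw, extd_pullback_eq_curl, Fin.sum_univ_three, hsub, wedge_smul, wedge_self,
      wedge_swap (dd (F 0)) (dd (F 2)), wedge_swap (dd (F 1)) (dd (F 0)), Fin.mk_one]
    linear_combination (norm := module) h • wedge (dd (F 2)) (dd (F 0))
  · refine ⟨aeval F (curl A 1) • dd (F 0) - aeval F (curl A 0) • dd (F 1), ?_⟩
    simp only [hw, extd_pullback_eq_curl, Fin.sum_univ_three, hsub, wedge_smul, wedge_self,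
      wedge_swap (dd (F 1)) (dd (F 0)), wedge_swap (dd (F 2)) (dd (F 1)), Fin.reduceFinMk]
    linear_combination (norm := module) h • wedge (dd (F 0)) (dd (F 1))

end Forms

/-! ### Local frames, Nullstellensatz, and consequences of homogeneity and dominance. -/

section Pullback

variable {n : ℕ}

theorem exists_isDualFrame {F : Fin 3 → S n} {q : Fin (n + 1) → ℂ} (hq : ¬ IsCriticalPoint F q) :
    ∃ δ V, IsDualFrame F δ V ∧ eval q δ = 1 := by
  rw [IsCriticalPoint, not_not, Matrix.mulVec_surjective_iff_exists_right_inverse] at hq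
  obtain ⟨N, hN⟩ := hq
  let P : Matrix (Fin 3) (Fin (n + 1)) (S n) := Matrix.of fun i j => pderiv j (F i)
  -- `N` is a constant right inverse of the Jacobian at `q`, so `M` is the identity at `q`; the
  -- adjugate turns it into a right inverse up to `det M` everywhere.
  let M : Matrix (Fin 3) (Fin 3) (S n) := P * N.map C
  let L : Matrix (Fin (n + 1)) (Fin 3) (S n) := N.map C * M.adjugate
  refine ⟨M.det, fun j => ∑ k, L k j • pderiv k, fun i j => ?_, ?_⟩
  · have h : P * L = M.det • (1 : Matrix (Fin 3) (Fin 3) (S n)) :=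
      (Matrix.mul_assoc P (N.map C) M.adjugate).symm.trans M.mul_adjugate
    have h' := congrFun (congrFun h i) j
    rw [Matrix.smul_apply, Matrix.one_apply, Matrix.mul_apply] at h'
    rw [← Derivation.coeFnAddMonoidHom_apply, map_sum, Finset.sum_apply]
    simpa [P, mul_comm] using h'
  · have hC : (N.map (C : ℂ → S n)).map (eval q) = N := by
      ext i j; simp
    have hM : M.map (eval q) = 1 := by
      have h := Matrix.map_mul (L := P) (M := N.map (C : ℂ → S n)) (f := eval q)
      rw [hC] at h
      exact h.trans hN
    rw [RingHom.map_det, RingHom.mapMatrix_apply, hM, Matrix.det_one]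

/-- The Nullstellensatz for ideals without zeros outside of the origin. -/
theorem exists_X_pow_mem {Q : Ideal (S n)} (hQ : ∀ q ≠ 0, ∃ f ∈ Q, eval q f ≠ 0) :
    ∃ N, ∀ i, X i ^ N ∈ Q := by
  have hX (i : Fin (n + 1)) : X i ∈ Q.radical := by
    rw [← vanishingIdeal_zeroLocus_eq_radical (K := ℂ) Q, mem_vanishingIdeal_iff]
    intro q hq
    by_contra hne
    obtain ⟨f, hf, hfq⟩ := hQ q (by rintro rfl; simp at hne)
    exact hfq (by simpa [aeval_eq_eval] using hq f hf)
  choose N hN using hX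
  refine ⟨∑ i, N i, fun i => ?_⟩
  exact Q.pow_mem_of_pow_mem (hN i) (Finset.single_le_sum (f := N) (fun _ _ => Nat.zero_le _)
    (Finset.mem_univ i))

theorem isRegularTriple_X_pow_castLE (hn : 3 ≤ n + 1) (N : ℕ) :
    IsRegularTriple fun j : Fin 3 => (X (Fin.castLE hn j) ^ N : S n) :=
  isRegularTriple_X_pow (Fin.castLE_injective hn) N

/-- Off the locus `δ = 0`, forming ideal quotients commutes with the pullback by `F`. -/
theorem IsDualFrame.exists_pow_mul_mem {F : Fin 3 → S n} {δ : S n}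
    {V : Fin 3 → Derivation ℂ (S n) (S n)} (hV : IsDualFrame F δ V) {ι : Type*} [Fintype ι]
    {J : Ideal (S 2)} {b : ι → S 2} (hJ : ∀ h, (∀ i, b i * h ∈ J) → h ∈ J) {t : S n}
    (ht : ∀ i, aeval F (b i) * t ∈ J.map (aeval F)) : ∃ N, δ ^ N * t ∈ J.map (aeval F) := by
  obtain ⟨T, _, _, _⟩ : ∃ (T : Type) (_ : CommRing T) (_ : Algebra (S n) T),
    IsLocalization.Away δ T := ⟨Localization.Away δ, inferInstance, inferInstance, inferInstance⟩
  let _ : Algebra ℂ T := ((algebraMap (S n) T).comp (algebraMap ℂ (S n))).toAlgebra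
  have : IsScalarTower ℂ (S n) T := .of_algebraMap_eq' rfl
  let f : S 2 →ₐ[ℂ] T := (IsScalarTower.toAlgHom ℂ (S n) T).comp (aeval F)
  -- `S 2` acts on the localization through `F`, so flatness applies to this action.
  let _ : Algebra (S 2) T := f.toRingHom.toAlgebra
  have : IsScalarTower ℂ (S 2) T := .of_algebraMap_eq' f.comp_algebraMap.symm
  have hf (x : S 2) : algebraMap (S 2) T x = algebraMap (S n) T (aeval F x) := rfl
  have : Module.Flat (S 2) T := hV.flat (T := T) fun i => by rw [hf, aeval_X]
  have hmap : J.map (algebraMap (S 2) T) = (J.map (aeval F)).map (algebraMap (S n) T) := by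
    exact (Ideal.map_map (aeval F).toRingHom (algebraMap (S n) T)).symm
  have h := mem_map_of_flat hJ (t := algebraMap (S n) T t) fun i => by
    rw [hf, ← map_mul, hmap]
    exact Ideal.mem_map_of_mem _ (ht i)
  rw [hmap, IsLocalization.algebraMap_mem_map_algebraMap_iff (Submonoid.powers δ)] at h
  obtain ⟨_, ⟨N, rfl⟩, hN⟩ := h
  exact ⟨N, hN⟩

theorem map_span_range (F : Fin 3 → S n) (A : Fin 3 → S 2) :
    (Ideal.span (Set.range A)).map (aeval F) = Ideal.span (Set.range fun i => aeval F (A i)) := by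
  rw [Ideal.map_span, ← Set.range_comp]
  rfl

/-- By Krull's principal ideal theorem, a common prime factor would bound the height by one. -/
theorem exists_not_dvd_of_two_le_height {R ι : Type*} [CommRing R] [IsNoetherianRing R]
    {A : ι → R} (hA : 2 ≤ (Ideal.span (Set.range A)).height) (p : R) (hp : Prime p) :
    ∃ j, ¬ p ∣ A j := by
  by_contra! h
  have hle : Ideal.span (Set.range A) ≤ Ideal.span {p} := by
    rw [Ideal.span_le]
    rintro _ ⟨j, rfl⟩
    exact Ideal.mem_span_singleton.mpr (h j)
  have h1 := hA.trans ((Ideal.height_mono hle).trans (Ideal.height_span_singleton_le_one hp.not_isUnit))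
  exact absurd h1 (by norm_num)

/-- This is `i_R dω = e ω`: Euler's formula contributes `e - 1`, and differentiating `∑ A_i x_i = 0`
contributes the remaining `1`. -/
theorem cross_curl_X {A : Fin 3 → S 2} {e : ℕ} (he : 2 ≤ e) (hA : ∀ i, (A i).IsHomogeneous (e - 1))
    (hR : ∑ i, A i * X i = 0) : cross (fun i => C (e : ℂ)⁻¹ * curl A i) X = A := by
  have hE (i : Fin 3) : ∑ j : Fin 3, X j * pderiv j (A i) = (e - 1) • A i :=
    (hA i).sum_X_mul_pderiv
  have hd (j : Fin 3) := congrArg (pderiv j) hR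
  have he0 : (C (e : ℂ)⁻¹ : S 2) * (e : S 2) = 1 := by
    rw [← map_natCast (C : ℂ →+* S 2) e, ← C_mul, inv_mul_cancel₀ (by norm_cast; omega), C_1]
  have hcast : ((e - 1 : ℕ) : S 2) = e - 1 := by
    rw [Nat.cast_sub (by omega), Nat.cast_one]
  simp only [Fin.sum_univ_three, nsmul_eq_mul, hcast] at hE
  simp only [Fin.sum_univ_three, map_add, Derivation.leibniz, map_zero, pderiv_X, smul_eq_mul] at hd
  have hd0 := hd 0
  have hd1 := hd 1
  have hd2 := hd 2
  simp at hd0 hd1 hd2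
  funext i
  fin_cases i <;> simp only [cross, curl, Fin.zero_eta, Fin.mk_one, Fin.reduceFinMk, Matrix.cons_val]
  · linear_combination C (e : ℂ)⁻¹ * (hE 0 - hd0) + A 0 * he0
  · linear_combination C (e : ℂ)⁻¹ * (hE 1 - hd1) + A 1 * he0
  · linear_combination C (e : ℂ)⁻¹ * (hE 2 - hd2) + A 2 * he0

theorem sum_cross_mul {R : Type*} [CommRing R] (a b : Fin 3 → R) :
    ∑ i, cross a b i * a i = 0 := by
  simp only [Fin.sum_univ_three, cross, Matrix.cons_val]
  ring

theorem vanishesAt_ofCoeffs {A : Fin 3 → S 2} {q : Fin 3 → ℂ} (h : ∀ i, eval q (A i) = 0) :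
    VanishesAt q (ofCoeffs A) :=
  Submodule.sum_mem _ fun i _ => Submodule.smul_mem_smul (RingHom.mem_ker.mpr (h i)) trivial

theorem vanishesAt_extd {A : Fin 3 → S 2} {q : Fin 3 → ℂ} (h : ∀ i, eval q (curl A i) = 0) :
    VanishesAt q (extd (ofCoeffs A)) := by
  rw [← pullback_X (ofCoeffs A), extd_pullback_eq_curl]
  have h' (i : Fin 3) (w : Form2 2) :
      aeval (X : Fin 3 → S 2) (curl A i) • w ∈ RingHom.ker (eval q) • (⊤ : Submodule (S 2) (Form2 2)) :=
    Submodule.smul_mem_smul (RingHom.mem_ker.mpr (by simpa using h i)) trivial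
  exact add_mem (add_mem (h' _ _) (h' _ _)) (h' _ _)

theorem IsDominating.aeval_ne_zero {F : Fin 3 → S n} (hF : IsDominating F) {d : ℕ} {G : S 2}
    (hG : G.IsHomogeneous d) (h0 : G ≠ 0) : aeval F G ≠ 0 := by
  refine fun h => h0 (hF d G hG fun q _ => ?_)
  have h1 := congrArg (eval q) h
  rw [map_zero, ← coe_aeval_eq_eval, RingHom.coe_coe, ← AlgHom.comp_apply, comp_aeval] at h1
  rw [← coe_aeval_eq_eval]
  exact h1

theorem IsDominating.two_le {F : Fin 3 → S n} (hF : IsDominating F) {ν : ℕ}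
    (hν : ∀ i, (F i).IsHomogeneous ν) : 2 ≤ n := by
  have hν0 : ν ≠ 0 := by
    rintro rfl
    have hc (i : Fin 3) : ∃ c : ℂ, F i = C c := ⟨_, totalDegree_eq_zero_iff_eq_C.mp
      ((totalDegree_zero_iff_isHomogeneous _).mpr (hν i))⟩
    choose c hc using hc
    by_cases h0 : c 0 = 0
    · refine hF.aeval_ne_zero (isHomogeneous_X ℂ (0 : Fin 3)) (X_ne_zero _) ?_
      rw [aeval_X, hc, h0, C_0]
    · refine hF.aeval_ne_zero (G := C (c 1) * X 0 - C (c 0) * X 1) (d := 1) ?_ ?_ ?_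
      · exact ((isHomogeneous_X ℂ _).C_mul _).sub ((isHomogeneous_X ℂ _).C_mul _)
      · intro h
        have := congrArg (eval ![0, 1, 0]) h
        simp [h0] at this
      · simp [hc, mul_comm (C (c 0))]
  -- Dominance rules out homogeneous relations only. As `ν ≠ 0`, distinct degrees `d` give distinct
  -- degrees `ν * d`, so each homogeneous part of a relation is itself a relation.
  have hind : AlgebraicIndependent ℂ F := by
    rw [algebraicIndependent_iff]
    intro G hG
    rw [← sum_homogeneousComponent G]
    refine Finset.sum_eq_zero fun d hd => ?_
    by_contra h0
    refine hF.aeval_ne_zero (homogeneousComponent_isHomogeneous d G) h0 ?_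
    have h := congrArg (homogeneousComponent (ν * d)) hG
    rw [← sum_homogeneousComponent G, map_sum, map_sum, map_zero, Finset.sum_eq_single d] at h
    · rwa [homogeneousComponent_eq_self ((homogeneousComponent_isHomogeneous d G).aeval F hν)] at h
    · intro b _ hb
      rw [homogeneousComponent_of_mem ((homogeneousComponent_isHomogeneous b G).aeval F hν), if_neg]
      exact fun h => hb (Nat.eq_of_mul_eq_mul_left (Nat.pos_of_ne_zero hν0) h).symm
    · exact fun h => absurd hd h
  have h := hind.cardinalMk_le_trdeg
  rw [MvPolynomial.trdeg_of_isDomain] at h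
  simp at h
  have h' : 3 ≤ n + 1 := by exact_mod_cast h
  omega

end Pullback

/-! ### Generic pairs: the Kupka ideal is contained in the ideal of the `A_i(F)`. -/

section GenericPair

variable {n e : ℕ} {A : Fin 3 → S 2}

theorem IsFoliation.sum_mul_X (hω : IsFoliation 2 e (ofCoeffs A)) :
    ∑ i : Fin 3, A i * X i = 0 := by
  have h := hω.descends
  rw [← pullback_X (ofCoeffs A), contract_pullback] at h
  simpa [radial] using h

/-- The coefficients of `ω` are the minors of the matrix with columns `e⁻¹ • rot ω` and `x`. -/
theorem IsFoliation.cross_curl (hω : IsFoliation 2 e (ofCoeffs A)) :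
    cross (fun i => C (e : ℂ)⁻¹ * curl A i) X = A :=
  cross_curl_X hω.two_le (fun i => by simpa only [coeff1_ofCoeffs] using hω.homogeneous i)
    hω.sum_mul_X

theorem IsFoliation.ne_zero_coeffs (hω : IsFoliation 2 e (ofCoeffs A)) : A ≠ 0 := by
  rintro rfl
  exact hω.ne_zero (by simp [ofCoeffs])

theorem IsFoliation.exists_not_dvd (hω : IsFoliation 2 e (ofCoeffs A)) (p : S 2) (hp : Prime p) :
    ∃ j, ¬ p ∣ A j :=
  exists_not_dvd_of_two_le_height
    (hω.codim_sing.trans (Ideal.height_mono (singularIdeal_ofCoeffs_le A))) p hp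

theorem IsFoliation.sum_mul_curl (hω : IsFoliation 2 e (ofCoeffs A)) :
    ∑ i, A i * curl A i = 0 := by
  have h := sum_cross_mul (fun i => C (e : ℂ)⁻¹ * curl A i) X
  rw [hω.cross_curl] at h
  have he : (C (e : ℂ)⁻¹ : S 2) ≠ 0 := by
    have := hω.two_le
    rw [Ne, C_eq_zero, inv_eq_zero, Nat.cast_eq_zero]
    omega
  refine (mul_eq_zero.mp (?_ : C (e : ℂ)⁻¹ * _ = 0)).resolve_left he
  rw [Finset.mul_sum, ← h]
  exact Finset.sum_congr rfl fun i _ => by ring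

/-- The ideal of `ω` is unmixed: no component lies in the zero locus of `dω`. -/
theorem IsFoliation.mem_of_curl_mul_mem (hω : IsFoliation 2 e (ofCoeffs A))
    (hK : OnlyKupkaSing (ofCoeffs A)) (h : S 2)
    (hh : ∀ i, curl A i * h ∈ Ideal.span (Set.range A)) : h ∈ Ideal.span (Set.range A) := by
  let Q : Ideal (S 2) := Submodule.comap (LinearMap.mulLeft (S 2) h)
    (Ideal.span (Set.range A))
  have hQ (f : S 2) : f ∈ Q ↔ h * f ∈ Ideal.span (Set.range A) := Iff.rfl
  -- The quotient `(J : h)` contains every `A_i` and every `curl A i`. By the Kupka condition these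
  -- have no common zero off the origin, so saturation of `J` finishes.
  obtain ⟨N, hN⟩ := exists_X_pow_mem (Q := Q) fun q hq => by
    by_contra! hzero
    have hA (i : Fin 3) : eval q (A i) = 0 :=
      hzero _ ((hQ _).mpr (Ideal.mul_mem_left _ _ (Ideal.subset_span ⟨i, rfl⟩)))
    have hB (i : Fin 3) : eval q (curl A i) = 0 :=
      hzero _ ((hQ _).mpr (by rw [mul_comm]; exact hh i))
    exact hK q hq (vanishesAt_ofCoeffs hA) (vanishesAt_extd hB)
  have key := mem_span_cross_of_mul_mem (a := fun i => C (e : ℂ)⁻¹ * curl A i) (b := X) (h := h)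
    (by rw [hω.cross_curl]; exact hω.ne_zero_coeffs)
    (by rw [hω.cross_curl]; exact hω.exists_not_dvd)
    (isRegularTriple_X_pow_castLE le_rfl N) (fun i => by rw [hω.cross_curl]; exact hN _)
  rwa [hω.cross_curl] at key

/-- Combines the two genericity conditions: such a `q` lies either in the indeterminacy locus or
over `sing(ω)`. -/
theorem IsGenericPair.not_isCriticalPoint {ν : ℕ} {F : Fin 3 → S n}
    (hg : IsGenericPair n e ν F (ofCoeffs A)) {q : Fin (n + 1) → ℂ} (hq : q ≠ 0)
    (hA : ∀ i, eval q (aeval F (A i)) = 0) : ¬ IsCriticalPoint F q := by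
  by_cases hF : evalMap F q = 0
  · exact hg.critical_points q hq hF
  · refine fun hc => hg.critical_values q hq hF hc (vanishesAt_ofCoeffs fun i => ?_)
    have h1 := hA i
    rw [← coe_aeval_eq_eval, RingHom.coe_coe, ← AlgHom.comp_apply, comp_aeval] at h1
    rw [← coe_aeval_eq_eval]
    exact h1

/-- The coefficients `A_i(F)` have no common factor. -/
theorem IsGenericPair.exists_not_dvd {ν : ℕ} {F : Fin 3 → S n}
    (hg : IsGenericPair n e ν F (ofCoeffs A)) (p : S n) (hp : Prime p) :
    ∃ j, ¬ p ∣ aeval F (A j) := by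
  by_contra! hdvd
  have hω := hg.foliation
  obtain ⟨i, hi⟩ := Function.ne_iff.mp hω.ne_zero_coeffs
  have hi' : aeval F (A i) ≠ 0 := hg.dominating.aeval_ne_zero
    (by simpa only [coeff1_ofCoeffs] using hω.homogeneous i) hi
  obtain ⟨g, hgi⟩ := hdvd i
  have hg0 : g ≠ 0 := by rintro rfl; exact hi' (by rw [hgi, mul_zero])
  -- With `A_i(F) = p g`, every `A_j(F) g` is a multiple of `A_i(F)`. On `ℂ³` the quotient of
  -- `(A_i)` by all `A_j` is `(A_i)`, so flatness gives `p g ∣ δ ^ N * g`.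
  have hframe {δ : S n} {V} (hV : IsDualFrame F δ V) : p ∣ δ := by
    obtain ⟨N, hN⟩ := hV.exists_pow_mul_mem (J := Ideal.span {A i}) (b := A) (t := g)
      (fun h hh => by
        simp only [Ideal.mem_span_singleton] at hh ⊢
        exact dvd_of_forall_dvd_mul hω.exists_not_dvd hi h fun j => by rw [mul_comm]; exact hh j)
      (fun j => by
        rw [Ideal.map_span, Set.image_singleton, Ideal.mem_span_singleton]
        obtain ⟨k, hk⟩ := hdvd j
        exact ⟨k, by rw [hk, hgi]; ring⟩)
    rw [Ideal.map_span, Set.image_singleton, Ideal.mem_span_singleton, hgi] at hN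
    exact hp.dvd_of_dvd_pow ((mul_dvd_mul_iff_right hg0).mp hN)
  -- At a zero `q ≠ 0` of `p` all `A_j(F)` vanish, so there is a frame with `δ(q) = 1`, against `p ∣
  -- δ`. Hence `p` divides a power of every variable, which is impossible with two distinct
  -- variables.
  obtain ⟨N, hN⟩ := exists_X_pow_mem (Q := Ideal.span {p}) fun q hq => by
    by_contra! hzero
    have hmem {f : S n} (hf : p ∣ f) : eval q f = 0 := hzero f (Ideal.mem_span_singleton.mpr hf)
    obtain ⟨δ, V, hV, hδ⟩ := exists_isDualFrame (hg.not_isCriticalPoint hq fun i => hmem (hdvd i))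
    exact one_ne_zero (hδ.symm.trans (hmem (hframe hV)))
  have hn := hg.dominating.two_le hg.homogeneous
  have hX (i : Fin (n + 1)) : p ∣ X i :=
    hp.dvd_of_dvd_pow (Ideal.mem_span_singleton.mp (hN i))
  have h01 := (hp.associated_of_dvd (X_prime (i := (0 : Fin (n + 1)))) (hX 0)).symm.dvd.trans
    (hX (Fin.last n))
  have h := X_dvd_X.mp h01
  have := congrArg Fin.val h
  simp at this
  omega

theorem IsGenericPair.kupkaIdeal_le {ν : ℕ} {F : Fin 3 → S n}
    (hg : IsGenericPair n e ν F (ofCoeffs A)) :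
    kupkaIdeal (pullback F (ofCoeffs A)) ≤ Ideal.span (Set.range fun i => aeval F (A i)) := by
  have hω := hg.foliation
  have hJ := singularIdeal_pullback_le F A
  refine sup_le (fun h hh => ?_) hJ
  have hframe {δ : S n} {V} (hV : IsDualFrame F δ V) :
      ∃ N, h * δ ^ N ∈ Ideal.span (Set.range fun i => aeval F (A i)) := by
    have hc := fun V W => hJ (mul_contract₂_mem_of_torsion hh V W)
    obtain ⟨h0, h1, h2⟩ := contract₂_extd_pullback hV A
    have hcurl (i : Fin 3) : aeval F (curl A i) * (δ ^ 2 * h) ∈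
        (Ideal.span (Set.range A)).map (aeval F) := by
      rw [map_span_range, mul_left_comm, mul_comm _ h, mul_left_comm]
      fin_cases i
      · exact h0 ▸ hc (V 1) (V 2)
      · exact h1 ▸ hc (V 2) (V 0)
      · exact h2 ▸ hc (V 0) (V 1)
    obtain ⟨N, hN⟩ := hV.exists_pow_mul_mem (hω.mem_of_curl_mul_mem hg.kupka) hcurl
    -- The extra two powers come from the factor `δ ^ 2` in the contractions of `dω`.
    refine ⟨N + 2, ?_⟩
    rw [map_span_range] at hN
    rwa [mul_comm h, pow_add, mul_assoc]
  let Q : Ideal (S n) :=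
    Submodule.comap (LinearMap.mulLeft (S n) h) (Ideal.span (Set.range fun i => aeval F (A i)))
  have hQ (f : S n) : f ∈ Q ↔ h * f ∈ Ideal.span (Set.range fun i => aeval F (A i)) := Iff.rfl
  -- A zero `q ≠ 0` of the quotient `(J_F : h)` is a zero of all `A_i(F)`, so a frame exists near
  -- `q`; it puts a power of `δ` into the quotient, although `δ(q) = 1`.
  obtain ⟨N, hN⟩ := exists_X_pow_mem (Q := Q) fun q hq => by
    by_contra! hzero
    obtain ⟨δ, V, hV, hδ⟩ := exists_isDualFrame (hg.not_isCriticalPoint hq fun i =>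
      hzero _ ((hQ _).mpr (Ideal.mul_mem_left _ _ (Ideal.subset_span ⟨i, rfl⟩))))
    obtain ⟨N, hN⟩ := hframe hV
    have := hzero _ ((hQ _).mpr hN)
    simp [hδ] at this
  have hcross : cross (fun i => aeval F (C (e : ℂ)⁻¹ * curl A i)) F = fun i => aeval F (A i) := by
    have h := hω.cross_curl
    funext i
    rw [← congrFun h i]
    fin_cases i <;>
      simp only [cross, Fin.zero_eta, Fin.mk_one, Fin.reduceFinMk, Matrix.cons_val, map_sub, map_mul,
        aeval_X]
  have hne : (fun i => aeval F (A i)) ≠ 0 := by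
    obtain ⟨i, hi⟩ := Function.ne_iff.mp hω.ne_zero_coeffs
    exact fun h => hg.dominating.aeval_ne_zero
      (by simpa only [coeff1_ofCoeffs] using hω.homogeneous i) hi (congrFun h i)
  have hn := hg.dominating.two_le hg.homogeneous
  -- Dominance forces `n ≥ 2`, so three variables are available for the regular sequence `X_j ^ N`.
  have key := mem_span_cross_of_mul_mem (a := fun i => aeval F (C (e : ℂ)⁻¹ * curl A i)) (b := F)
    (h := h) (by rwa [hcross]) (by rw [hcross]; exact hg.exists_not_dvd)
    (isRegularTriple_X_pow_castLE (by omega) N) (fun i => by rw [hcross]; exact hN _)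
  rwa [hcross] at key

end GenericPair

end Foliation

end

theorem mainTheorem8 (n e ν : ℕ)
    (A : Fin 3 → Foliation.S 2) (F : Fin 3 → Foliation.S n)
    (hgen : Foliation.IsGenericPair n e ν F (Foliation.ofCoeffs A)) :
    Foliation.unfoldingIdeal (Foliation.pullback F (Foliation.ofCoeffs A)) =
        Foliation.kupkaIdeal (Foliation.pullback F (Foliation.ofCoeffs A)) ∧
      Foliation.kupkaIdeal (Foliation.pullback F (Foliation.ofCoeffs A)) =
        Ideal.span {MvPolynomial.aeval F (A 0), MvPolynomial.aeval F (A 1),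
          MvPolynomial.aeval F (A 2)} := by
  have hspan : Ideal.span (Set.range fun i => aeval F (A i)) =
      Ideal.span {aeval F (A 0), aeval F (A 1), aeval F (A 2)} := by
    congr 1
    ext x
    simp [Fin.exists_fin_succ, eq_comm]
  have hIK := Foliation.unfoldingIdeal_le_kupkaIdeal (Foliation.pullback F (Foliation.ofCoeffs A))
  have hK := hgen.kupkaIdeal_le
  have hI : Ideal.span (Set.range fun i => aeval F (A i)) ≤
      Foliation.unfoldingIdeal (Foliation.pullback F (Foliation.ofCoeffs A)) := by
    rw [Ideal.span_le]
    rintro _ ⟨i, rfl⟩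
    exact Foliation.aeval_mem_unfoldingIdeal F A hgen.foliation.sum_mul_curl i
  rw [← hspan]
  exact ⟨le_antisymm hIK (hK.trans hI), le_antisymm hK (hI.trans hIK)⟩
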